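/- All vector spaces are real. $\mathbb R_+=[0,\infty)$. **Pseudonormed spaces.** Let $X$ be a Banach space, $Z$ a locally convex topological vector space, $B\subseteq Z$ a Banach space (continuously included), and $h:D(h)\subseteq X\to Z$ a one-to-one mapping with $0\in D(h)$, $h(0)=0$. Put $\mathcal M_0=\{x\in D(h): h(x)\in B\}$. Assume that there are a convex function $\nu:\mathbb R\to[0,\infty]$ and a number $K\in(0,\infty]$ such that $\lambda x\in\mathcal M_0$ and $\|h(\lambda x)\|_B\le\nu(\lambda)\|h(x)\|_B$ for all $x\in\mathcal M_0$ and $|\lambda|<K$, and such that $\nu(\lambda)/|\lambda|\to c_0$ as $|\lambda|\to0$ and $\nu(\lambda)/|\lambda|\to c_1$ as $|\lambda|\uparrow K$, where either $c_0=c_1=1$, or $c_0=0$ and $c_1=\infty$. Let $\psi$ be a homeomorphism of $\mathbb R_+$ onto itself with $\psi(0)=0$. Then $\mathcal M_0$ with the $p$-norm $[x]=\psi^{-1}(\|h(x)\|_B)$ and the metric $d(x_1,x_2)=\|h(x_1)-h(x_2)\|_B$ is called a *$pn$-space* (pseudonormed space). Weak convergence $x_m\rightharpoonup x$ in $\mathcal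 M_0$ means $h(x_m)\rightharpoonup h(x)$ weakly in $B$, and the weak topology of $\mathcal M_0$ is the one induced through $h$ by the weak topology of $B$. $\mathcal M_0$ is *weakly complete* if $h(\mathcal M_0)$ is weakly closed in $B$, and *reflexive* if each of its weakly closed subsets on which $[\cdot]$ is bounded is weakly compact. **Theorem 2.** Let $X,Y$ be Banach spaces, $\langle\cdot,\cdot\rangle$ the dual form of the pair $(Y,Y^*)$, $\mathcal M_0\subseteq X$ a $pn$-space, and $f:D(f)\subseteq X\to Y$ a mapping with $\mathcal M_0\subseteq D(f)$. Assume: 1) $\mathcal M_0$ is weakly complete, and $f:\mathcal M_0\to Y$ is weakly compact: whenever $x_m\rightharpoonup x_0$ in $\mathcal M_0$, $x_0\in\mathcal M_0$, there is a subsequence with $f(x_{m_k})\rightharpoonup f(x_0)$ weakly in $Y$. 2) There are a subset $X_0\subseteq X$ equipped with a topology, a subset $X_1\subseteq X_0\cap\mathcal M_0$ that is dense in $X_0$ and dense in $\mathcal M_0$, a mapping $g:X_0\to Y^*$, and a continuous function $\varphi:\mathbb R_+\to\mathbb R$, nondecreasing on $[\tau_0,\infty)$ for some $\tau_0\ge0$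 and with $\varphi(\tau_1)>0$ for some $\tau_1>0$, such that $$\langle f(x),g(x)\rangle\ \ge\ \varphi([x])\,[x]\qquad\text{for all }x\in X_1 .$$ Moreover, one of the following conditions holds: ($\alpha$) $X_0=X_1$ is a linear subspace of $X$ which, with its topology, is a separable topological vector space, the inclusion $X_0\subseteq\mathcal M_0$ is continuous, $g=L$ is linear and continuous on $X_0$, $\mathcal M_0$ is reflexive, and $\ker L^*=\{0\}$, that is, $v\in Y$ and $\langle v,Lx\rangle=0$ for all $x\in X_0$ imply $v=0$; ($\beta$) $Y$ is reflexive and separable; $g$ is bounded, that is, it maps each subset of $X_1$ on which $[\cdot]$ is bounded to a bounded subset of $Y^*$; $g(X_1)$ contains a dense linear subspace of $Y^*$; and $g$ is one-to-one on $X_1$ with a weakly compact (weakly continuous) inverse from $Y^*$ to $\mathcal M_0$: whenever $x_m\in X_1$ and $g(x_m)\rightharpoonup z$ weakly in $Y^*$, some subsequence of $(x_m)$ converges weakly in $\mathcal M_0$ to an element of $\mathcal M_0$, which is $g^{-1}(z)$ if $z\in g(X_1)$. Let $y\in Y$ be such that for some $r>0$ $$\varphi([x])\,[x]\ \ge\ \langle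 y,g(x)\rangle\qquad\text{for all }x\in X_1\text{ with }[x]\ge r .$$ Then the equation $f(x)=y$ has a solution $x\in\mathcal M_0$. -/

import Mathlib

open Set Filter Topology
open scoped NNReal ENNReal

/-- Weak convergence `u n ⇀ a` of a sequence in a real normed space. -/
def WeakTendsto {E : Type*} [NormedAddCommGroup E] [NormedSpace ℝ E] (u : ℕ → E) (a : E) : Prop :=
  ∀ l : StrongDual ℝ E, Tendsto (fun n => l (u n)) atTop (𝓝 (l a))

/-- Reflexivity of a real normed space: the canonical embedding into the bidual is onto. -/
def IsReflexiveSpace (E : Type*) [NormedAddCommGroup E] [NormedSpace ℝ E] : Prop :=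
  Function.Surjective (NormedSpace.inclusionInDoubleDual ℝ E)

/-- The conditions on the comparison function `ν : ℝ → [0, ∞]` and the number `K ∈ (0, ∞]`:
`ν` is convex, and `ν t / |t|` tends to `c₀` as `|t| → 0` and to `c₁` as `|t| → K` (from below),
where either `c₀ = c₁ = 1`, or `c₀ = 0` and `c₁ = ∞`. -/
structure IsScaleFunction (ν : ℝ → ℝ≥0∞) (K : ℝ≥0∞) : Prop where
  K_pos : 0 < K
  convex : ConvexOn ℝ≥0 univ ν
  limits : ∃ c₀ c₁ : ℝ≥0∞, ((c₀ = 1 ∧ c₁ = 1) ∨ (c₀ = 0 ∧ c₁ = ∞)) ∧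
    Tendsto (fun t : ℝ => ν t / ‖t‖ₑ) (comap (fun t : ℝ => ‖t‖ₑ) (𝓝[>] 0)) (𝓝 c₀) ∧
    Tendsto (fun t : ℝ => ν t / ‖t‖ₑ) (comap (fun t : ℝ => ‖t‖ₑ) (𝓝[<] K)) (𝓝 c₁)

/-- The data defining a pseudonormed space `𝓜 = {x ∈ D(h) | h x ∈ B}` inside `X`: a mapping
`h : D(h) ⊆ X → Z` which is one-to-one with `h 0 = 0`, a Banach space `B` contained in `Z`
(through the injection `incl`), such that
`‖h (t x)‖_B ≤ ν t ‖h x‖_B` for `x ∈ 𝓜`, `|t| < K`, and a homeomorphism `ψ` of `[0, ∞)`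
fixing `0`, which gives the `p`-norm `[x] = ψ⁻¹ (‖h x‖_B)`. Only the values of `h` on `D(h)`
matter. -/
structure PNSpace (X Z B : Type*) [NormedAddCommGroup X] [NormedSpace ℝ X]
    [AddCommGroup Z] [Module ℝ Z] [TopologicalSpace Z]
    [NormedAddCommGroup B] [NormedSpace ℝ B] where
  /-- the inclusion `B ⊆ Z` -/
  incl : B →L[ℝ] Z
  incl_injective : Function.Injective incl
  /-- the domain `D(h)` -/
  dom : Set X
  /-- the mapping `h` -/
  h : X → Z
  zero_mem_dom : (0 : X) ∈ dom
  h_zero : h 0 = 0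
  injOn_h : InjOn h dom
  scaling : ∃ (ν : ℝ → ℝ≥0∞) (K : ℝ≥0∞), IsScaleFunction ν K ∧
    ∀ x ∈ dom, ∀ b : B, h x = incl b → ∀ t : ℝ, ‖t‖ₑ < K →
      t • x ∈ dom ∧ ∃ b' : B, h (t • x) = incl b' ∧ ‖b'‖ₑ ≤ ν t * ‖b‖ₑ
  /-- the gauge `ψ` -/
  ψ : ℝ≥0 ≃ₜ ℝ≥0
  ψ_zero : ψ 0 = 0

namespace PNSpace

variable {X Z B Y : Type*} [NormedAddCommGroup X] [NormedSpace ℝ X]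
  [AddCommGroup Z] [Module ℝ Z] [TopologicalSpace Z]
  [NormedAddCommGroup B] [NormedSpace ℝ B]
  [NormedAddCommGroup Y] [NormedSpace ℝ Y]

/-- The underlying subset `𝓜 = {x ∈ D(h) | h x ∈ B}` of `X`. -/
def carrier (M : PNSpace X Z B) : Set X := {x | x ∈ M.dom ∧ ∃ b : B, M.h x = M.incl b}

/-- The points of `𝓜`, as a type of its own, so that it does not inherit the topology of `X`. -/
@[ext]
structure Pt (M : PNSpace X Z B) where
  /-- the point as an element of `X` -/
  val : X
  mem : val ∈ M.carrier

/-- The element `h x` of `B`, for `x ∈ 𝓜`. -/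
noncomputable def coord (M : PNSpace X Z B) (x : M.Pt) : B := x.mem.2.choose

theorem incl_coord (M : PNSpace X Z B) (x : M.Pt) : M.incl (M.coord x) = M.h x.val :=
  x.mem.2.choose_spec.symm

theorem coord_injective (M : PNSpace X Z B) : Function.Injective M.coord := by
  intro x y hxy
  apply Pt.ext
  apply M.injOn_h x.mem.1 y.mem.1
  have h1 := M.incl_coord x
  have h2 := M.incl_coord y
  rw [hxy] at h1
  exact h1.symm.trans h2

/-- The metric `d (x₁, x₂) = ‖h x₁ - h x₂‖_B` of `𝓜`. -/
noncomputable instance (M : PNSpace X Z B) : MetricSpace M.Pt :=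
  MetricSpace.induced M.coord M.coord_injective inferInstance

/-- The `p`-norm `[x] = ψ⁻¹ (‖h x‖_B)`. -/
noncomputable def pnorm (M : PNSpace X Z B) (x : M.Pt) : ℝ≥0 := M.ψ.symm ‖M.coord x‖₊

/-- The weak topology of `𝓜`: the one induced through `h` by the weak topology of `B`. -/
noncomputable abbrev weakTopology (M : PNSpace X Z B) : TopologicalSpace M.Pt :=
  TopologicalSpace.induced (fun x => toWeakSpace ℝ B (M.coord x)) inferInstance

/-- Weak convergence of a sequence in `𝓜`: weak convergence of its image under `h` in `B`. -/
def WeakTendsto (M : PNSpace X Z B) (u : ℕ → M.Pt) (a : M.Pt) : Prop :=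
  _root_.WeakTendsto (fun n => M.coord (u n)) (M.coord a)

/-- `𝓜` is weakly complete: `h(𝓜)` is weakly closed in `B`. -/
def WeaklyComplete (M : PNSpace X Z B) : Prop :=
  IsClosed (range fun x : M.Pt => toWeakSpace ℝ B (M.coord x))

/-- `𝓜` is "reflexive": its bounded weakly closed subsets are weakly compact. -/
def Reflexive (M : PNSpace X Z B) : Prop :=
  ∀ S : Set M.Pt, (∃ C : ℝ≥0, ∀ x ∈ S, M.pnorm x ≤ C) →
    IsClosed[M.weakTopology] S → @IsCompact M.Pt M.weakTopology S

/-- `f : 𝓜 → Y` is weakly compact (weakly "continuous"). -/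
def WeaklyCompactMap (M : PNSpace X Z B) (f : X → Y) : Prop :=
  ∀ (u : ℕ → M.Pt) (a : M.Pt), M.WeakTendsto u a →
    ∃ k : ℕ → ℕ, StrictMono k ∧ _root_.WeakTendsto (fun m => f (u (k m)).val) (f a.val)

end PNSpace

section Conditions

variable {X Z B Y : Type*} [NormedAddCommGroup X] [NormedSpace ℝ X]
  [AddCommGroup Z] [Module ℝ Z] [TopologicalSpace Z]
  [NormedAddCommGroup B] [NormedSpace ℝ B]
  [NormedAddCommGroup Y] [NormedSpace ℝ Y]

/-- `f` and `g` form a "coercive" pair, in the generalized sense, on a set `X₁ ⊆ X₀ ∩ 𝓜` which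
is dense in `X₀` (for the topology `τ` of `X₀`) and in `𝓜`. Only the values of `g` on `X₀` and
those of `f` on `𝓜` matter. -/
structure CoercivePair (M : PNSpace X Z B) (f : X → Y) (g : X → StrongDual ℝ Y) (φ : ℝ≥0 → ℝ)
    (X₀ X₁ : Set X) (τ : TopologicalSpace X₀) : Prop where
  subset_dom : X₁ ⊆ X₀
  subset_carrier : X₁ ⊆ M.carrier
  dense_dom : @Dense X₀ τ {x | (x : X) ∈ X₁}
  dense_carrier : Dense {x : M.Pt | x.val ∈ X₁}
  continuous_φ : Continuous φ
  monotone_φ : ∃ τ₀ : ℝ≥0, MonotoneOn φ (Ici τ₀)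
  pos_φ : ∃ τ₁ : ℝ≥0, 0 < τ₁ ∧ 0 < φ τ₁
  coercive : ∀ x : M.Pt, x.val ∈ X₁ → φ (M.pnorm x) * M.pnorm x ≤ g x.val (f x.val)

/-- The subset `S` of the vector space `X`, with its own topology `τ`, is a topological vector
space for the operations of `X`. -/
structure IsTVS (S : Set X) (τ : TopologicalSpace S) : Prop where
  zero_mem : (0 : X) ∈ S
  add_mem : ∀ {x y : X}, x ∈ S → y ∈ S → x + y ∈ S
  smul_mem : ∀ (c : ℝ) {x : X}, x ∈ S → c • x ∈ S
  continuous_add : @Continuous (S × S) S (@instTopologicalSpaceProd S S τ τ) τ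
    fun p => ⟨p.1 + p.2, add_mem p.1.2 p.2.2⟩
  continuous_smul : @Continuous (ℝ × S) S (@instTopologicalSpaceProd ℝ S inferInstance τ) τ
    fun p => ⟨p.1 • p.2, smul_mem p.1 p.2.2⟩

/-- Condition (α): `g = L` is linear and continuous on `X₀ = X₁`, which is a separable topological
vector space contained in `𝓜` (with continuous inclusion), `𝓜` is "reflexive", and
`ker L* = {0}`, where `⟨L* v, x⟩ = ⟨v, L x⟩` for `v ∈ Y`, `x ∈ X₀`. The density of `X₀` in `𝓜` is
part of `CoercivePair`. -/
structure ConditionAlpha (M : PNSpace X Z B) (g : X → StrongDual ℝ Y)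
    (X₀ X₁ : Set X) (τ : TopologicalSpace X₀) : Prop where
  dom_eq : X₀ = X₁
  isTVS : IsTVS X₀ τ
  separable : @TopologicalSpace.SeparableSpace X₀ τ
  subset_carrier : X₀ ⊆ M.carrier
  continuous_inclusion :
    @Continuous X₀ M.Pt τ inferInstance (fun x => PNSpace.Pt.mk (x : X) (subset_carrier x.2))
  map_add : ∀ x ∈ X₀, ∀ y ∈ X₀, g (x + y) = g x + g y
  map_smul : ∀ (c : ℝ), ∀ x ∈ X₀, g (c • x) = c • g x
  continuous_map : @Continuous X₀ (StrongDual ℝ Y) τ inferInstance (fun x => g x)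
  reflexive : M.Reflexive
  ker_adjoint : ∀ v : Y, (∀ x ∈ X₀, g x v = 0) → v = 0

/-- Condition (β): `Y` is reflexive and separable, `g` is bounded (it maps the subsets of `X₁` that
are bounded in `𝓜` to bounded sets), `g(X₁)` contains a dense linear subspace of `Y*`, and `g` is
one-to-one on `X₁` with a weakly compact (weakly continuous) inverse from `Y*` to `𝓜`: if
`g (u m) ⇀ z` weakly in `Y*`, then a subsequence of `u m` converges weakly in `𝓜`, and its limit
is `g⁻¹ z` if `z ∈ g(X₁)`. -/
structure ConditionBeta (M : PNSpace X Z B) (g : X → StrongDual ℝ Y) (X₁ : Set X) : Prop where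
  reflexive : IsReflexiveSpace Y
  separable : TopologicalSpace.SeparableSpace Y
  bounded : ∀ C : ℝ≥0, ∃ R : ℝ, ∀ x : M.Pt, x.val ∈ X₁ → M.pnorm x ≤ C → ‖g x.val‖ ≤ R
  dense_image : ∃ V : Submodule ℝ (StrongDual ℝ Y),
    Dense (V : Set (StrongDual ℝ Y)) ∧ (V : Set (StrongDual ℝ Y)) ⊆ g '' X₁
  injOn : InjOn g X₁
  inverse : ∀ (u : ℕ → M.Pt) (z : StrongDual ℝ Y), (∀ m, (u m).val ∈ X₁) →
    WeakTendsto (fun m => g (u m).val) z →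
    ∃ k : ℕ → ℕ, StrictMono k ∧ ∃ a : M.Pt, M.WeakTendsto (fun m => u (k m)) a ∧
      ∀ x : M.Pt, x.val ∈ X₁ → g x.val = z → a = x

end Conditions

section Brouwer

open MeasureTheory Polynomial

/-- A family of integrands which is polynomial in a parameter `t` has constant integral if it does
so for small nonnegative `t`. -/
theorem setIntegral_eq_of_polynomial {E : Type*} [MeasurableSpace E] {μ : Measure E} {s : Set E}
    {q : ℝ → E → ℝ} {N : ℕ} (hq : ∀ x, ∃ p : ℝ[X], p.natDegree ≤ N ∧ ∀ t, p.eval t = q t x)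
    (hint : ∀ t, IntegrableOn (q t) s μ) {ε c : ℝ} (hε : 0 < ε)
    (hc : ∀ t, 0 ≤ t → t < ε → ∫ x in s, q t x ∂μ = c) (t : ℝ) : ∫ x in s, q t x ∂μ = c := by
  let v : ℕ → ℝ := fun i => ε * (i / (N + 1))
  have hN : (0 : ℝ) < N + 1 := by positivity
  have hv : InjOn v (Finset.range (N + 1)) := by
    intro i _ j _ hij
    have h1 := mul_left_cancel₀ hε.ne' hij
    rw [div_left_inj' hN.ne'] at h1
    exact_mod_cast h1
  have key : ∀ x, q t x = ∑ i ∈ Finset.range (N + 1),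
      q (v i) x * (Lagrange.basis (Finset.range (N + 1)) v i).eval t := by
    intro x
    obtain ⟨p, hp, hpq⟩ := hq x
    have h1 : p = Lagrange.interpolate (Finset.range (N + 1)) v fun i => p.eval (v i) := by
      apply Lagrange.eq_interpolate hv
      rw [Finset.card_range]
      exact (degree_le_of_natDegree_le hp).trans_lt (by exact_mod_cast Nat.lt_succ_self N)
    rw [← hpq t]
    conv_lhs => rw [h1]
    rw [Lagrange.interpolate_apply, eval_finsetSum]
    exact Finset.sum_congr rfl fun i _ => by rw [eval_mul, eval_C, hpq]
  calc ∫ x in s, q t x ∂μ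
      = ∫ x in s, ∑ i ∈ Finset.range (N + 1),
          q (v i) x * (Lagrange.basis (Finset.range (N + 1)) v i).eval t ∂μ := by
        simp only [← key]
    _ = ∑ i ∈ Finset.range (N + 1),
          c * (Lagrange.basis (Finset.range (N + 1)) v i).eval t := by
        rw [integral_finsetSum _ fun i _ => (hint (v i)).mul_const _]
        refine Finset.sum_congr rfl fun i hi => ?_
        rw [integral_mul_const, hc]
        · positivity
        · have : (i : ℝ) < N + 1 := by exact_mod_cast Finset.mem_range.1 hi
          have h2 : (i : ℝ) / (N + 1) < 1 := (div_lt_one hN).2 this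
          exact mul_lt_of_lt_one_right hε h2
    _ = c := by
        rw [← Finset.mul_sum, ← eval_finsetSum, Lagrange.sum_basis hv (by simp), eval_one, mul_one]

variable {E : Type*} [NormedAddCommGroup E] [InnerProductSpace ℝ E] [FiniteDimensional ℝ E]

/-- `det (1 + t A)` is a polynomial in `t`. -/
theorem exists_polynomial_eval_eq_det (A : E →L[ℝ] E) :
    ∃ p : ℝ[X], p.natDegree ≤ Module.finrank ℝ E ∧
      ∀ t, p.eval t = (ContinuousLinearMap.id ℝ E + t • A).det := by
  classical
  let b := Module.finBasis ℝ E
  let M := LinearMap.toMatrix b b (A : E →ₗ[ℝ] E)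
  refine ⟨((X : ℝ[X]) • M.map C + (1 : Matrix _ _ ℝ).map C).det, ?_, fun t => ?_⟩
  · simpa using natDegree_det_X_add_C_le M 1
  · rw [← coe_evalRingHom, RingHom.map_det, ContinuousLinearMap.det, ← LinearMap.det_toMatrix b]
    congr 1
    ext i j
    by_cases hij : i = j
    · simp [M, LinearMap.toMatrix_apply, hij]
      ring
    · simp [M, LinearMap.toMatrix_apply, hij]
      ring

/-- A small multiple of a Lipschitz perturbation supported in a ball maps that ball bijectively
onto itself. -/
theorem image_closedBall_add_smul {v : E → E} {R : ℝ} (hvR : ∀ x, R < ‖x‖ → v x = 0) {K : ℝ≥0}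
    (hK : LipschitzWith K v) {t : ℝ} (ht : ‖t‖₊ * K < 1) :
    Function.Injective (fun x => x + t • v x) ∧
      (fun x => x + t • v x) '' Metric.closedBall 0 R = Metric.closedBall 0 R := by
  have happ : ApproximatesLinearOn (fun x => x + t • v x)
      ((ContinuousLinearEquiv.refl ℝ E : E ≃L[ℝ] E) : E →L[ℝ] E) univ (‖t‖₊ * K) := by
    intro x _ y _
    have h1 : x + t • v x - (y + t • v y) -
        ((ContinuousLinearEquiv.refl ℝ E : E ≃L[ℝ] E) : E →L[ℝ] E) (x - y) =
        t • (v x - v y) := by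
      simp only [ContinuousLinearEquiv.coe_coe, ContinuousLinearEquiv.coe_refl', id_eq, smul_sub]
      abel
    rw [h1, norm_smul]
    have h2 := hK.dist_le_mul x y
    rw [dist_eq_norm, dist_eq_norm] at h2
    calc ‖t‖ * ‖v x - v y‖ ≤ ‖t‖ * (K * ‖x - y‖) := by gcongr
      _ = _ := by simp [mul_assoc]
  have hc : Subsingleton E ∨ ‖t‖₊ * K <
      ‖((ContinuousLinearEquiv.refl ℝ E : E ≃L[ℝ] E).symm : E →L[ℝ] E)‖₊⁻¹ := by
    rcases subsingleton_or_nontrivial E with h | h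
    · exact Or.inl h
    · right
      have : ‖((ContinuousLinearEquiv.refl ℝ E : E ≃L[ℝ] E).symm : E →L[ℝ] E)‖₊ = 1 := by
        ext; exact ContinuousLinearMap.norm_id
      rwa [this, inv_one]
  have hinj : Function.Injective (fun x => x + t • v x) := Set.injOn_univ.1 (happ.injOn hc)
  refine ⟨hinj, Subset.antisymm ?_ ?_⟩
  · rintro _ ⟨x, hx, rfl⟩
    rw [mem_closedBall_zero_iff] at hx ⊢
    by_contra! h
    have h1 : x + t • v x = x := hinj (by simp [hvR _ h])
    simp only [h1] at h
    exact absurd hx h.not_ge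
  · intro z hz
    obtain ⟨x, hx⟩ := happ.surjective hc z
    refine ⟨x, ?_, hx⟩
    rw [mem_closedBall_zero_iff] at hz ⊢
    by_contra! h
    simp only [hvR x h, smul_zero, add_zero] at hx
    rw [hx] at h
    exact absurd hz h.not_ge

/-- A `C¹` map which is the identity off a ball has a zero. -/
theorem exists_add_eq_zero_of_contDiff {v : E → E} (hv : ContDiff ℝ 1 v) {R : ℝ} (hR : 0 < R)
    (hvR : ∀ x, R < ‖x‖ → v x = 0) : ∃ x, x + v x = 0 := by
  by_contra! hne
  borelize E
  have hBc : IsCompact (Metric.closedBall (0 : E) R) := isCompact_closedBall _ _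
  have hcont : Continuous fun x => x + v x := continuous_id.add hv.continuous
  have hdc : Continuous fun x => fderiv ℝ v x := hv.continuous_fderiv one_ne_zero
  obtain ⟨x₀, -, hx₀⟩ := hBc.exists_isMinOn ⟨0, by simp [hR.le]⟩ hcont.norm.continuousOn
  set δ := ‖x₀ + v x₀‖ with hδdef
  have hδ : 0 < δ := norm_pos_iff.2 (hne x₀)
  have hδle : ∀ x ∈ Metric.closedBall (0 : E) R, δ ≤ ‖x + v x‖ := fun x hx => hx₀ hx
  obtain ⟨C₀, hC₀⟩ := hBc.exists_bound_of_continuousOn hcont.continuousOn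
  set C := C₀ ^ 2 + R ^ 2 with hC
  have hsupp : HasCompactSupport v :=
    HasCompactSupport.intro hBc fun x hx => hvR x (by simpa using hx)
  obtain ⟨K, hK⟩ := hv.lipschitzWith_of_hasCompactSupport hsupp one_ne_zero
  obtain ⟨η, hη, hdet⟩ : ∃ η > 0, ∀ A : E →L[ℝ] E, dist A (ContinuousLinearMap.id ℝ E) < η →
      0 < A.det := by
    have h1 : (ContinuousLinearMap.id ℝ E).det = 1 := by
      simp [ContinuousLinearMap.det]
    have h2 := (ContinuousLinearMap.continuous_det (𝕜 := ℝ) (E := E)).continuousAt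
      (x := ContinuousLinearMap.id ℝ E)
    have h3 := h2.eventually_const_lt (h1 ▸ zero_lt_one)
    exact Metric.eventually_nhds_iff.1 h3
  let q : ℕ → ℝ → E → ℝ := fun k t x =>
    (C - ‖x + t • v x‖ ^ 2) ^ k * (ContinuousLinearMap.id ℝ E + t • fderiv ℝ v x).det
  have hqc : ∀ k t, Continuous (q k t) := by
    intro k t
    have := hv.continuous
    refine Continuous.mul (by fun_prop) ?_
    exact ContinuousLinearMap.continuous_det.comp (by fun_prop)
  have hqp : ∀ k x, ∃ p : ℝ[X], p.natDegree ≤ 2 * k + Module.finrank ℝ E ∧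
      ∀ t, p.eval t = q k t x := by
    intro k x
    obtain ⟨p, hp, hpe⟩ := exists_polynomial_eval_eq_det (fderiv ℝ v x)
    refine ⟨(Polynomial.C (C - ‖x‖ ^ 2) - Polynomial.C (2 * inner ℝ x (v x)) * X
      - Polynomial.C (‖v x‖ ^ 2) * X ^ 2) ^ k * p, ?_, fun t => ?_⟩
    · refine natDegree_mul_le_of_le ?_ hp
      rw [mul_comm 2 k]
      refine natDegree_pow_le_of_le k ?_
      compute_degree
    · simp only [q, eval_mul, hpe, eval_pow, eval_sub, eval_C, eval_X]
      congr 2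
      rw [norm_add_sq_real, inner_smul_right, norm_smul, mul_pow, Real.norm_eq_abs, sq_abs]
      ring
  have hqi : ∀ k t, IntegrableOn (q k t) (Metric.closedBall 0 R) volume := fun k t =>
    (hqc k t).continuousOn.integrableOn_compact hBc
  have hconst : ∀ k, ∫ x in Metric.closedBall 0 R, q k 1 x =
      ∫ x in Metric.closedBall (0 : E) R, (C - ‖x‖ ^ 2) ^ k := by
    intro k
    have hK1 : (0 : ℝ) < K + 1 := by positivity
    refine setIntegral_eq_of_polynomial (hqp k) (hqi k) (ε := min 1 η / (K + 1)) (by positivity)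
      (fun t ht0 ht => ?_) 1
    rw [lt_div_iff₀ hK1, lt_min_iff] at ht
    have htK : t * K < 1 ∧ t * K < η := ⟨by nlinarith, by nlinarith⟩
    obtain ⟨hinj, himg⟩ := image_closedBall_add_smul hvR hK (t := t) (by
      rw [← NNReal.coe_lt_coe]
      simpa [abs_of_nonneg ht0] using htK.1)
    have hder : ∀ x ∈ Metric.closedBall (0 : E) R, HasFDerivWithinAt (fun x => x + t • v x)
        (ContinuousLinearMap.id ℝ E + t • fderiv ℝ v x) (Metric.closedBall 0 R) x := fun x _ =>
      ((hasFDerivAt_id x).add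
        ((hv.differentiable one_ne_zero x).hasFDerivAt.const_smul t)).hasFDerivWithinAt
    have hcv := integral_image_eq_integral_abs_det_fderiv_smul volume
      Metric.isClosed_closedBall.measurableSet hder hinj.injOn fun y => (C - ‖y‖ ^ 2) ^ k
    rw [himg] at hcv
    rw [hcv]
    refine setIntegral_congr_fun Metric.isClosed_closedBall.measurableSet fun x _ => ?_
    have hpos : 0 < (ContinuousLinearMap.id ℝ E + t • fderiv ℝ v x).det := by
      apply hdet
      rw [dist_eq_norm, add_sub_cancel_left, norm_smul, Real.norm_of_nonneg ht0]
      exact (mul_le_mul_of_nonneg_left (norm_fderiv_le_of_lipschitz ℝ hK) ht0).trans_lt htK.2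
    simp only [q, abs_of_pos hpos, smul_eq_mul, mul_comm]
  set D := ∫ x in Metric.closedBall (0 : E) R,
    |(ContinuousLinearMap.id ℝ E + (1 : ℝ) • fderiv ℝ v x).det|
  have hCδ : 0 ≤ C - δ ^ 2 := by
    have h1 := hδle 0 (by simp [hR.le])
    have h2 := hC₀ 0 (by simp [hR.le])
    nlinarith [sq_nonneg R]
  have hupper : ∀ k, ∫ x in Metric.closedBall (0 : E) R, (C - ‖x‖ ^ 2) ^ k ≤
      (C - δ ^ 2) ^ k * D := by
    intro k
    rw [← hconst, ← integral_const_mul]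
    refine setIntegral_mono_on (hqi k 1) ?_ Metric.isClosed_closedBall.measurableSet
      fun x hx => ?_
    · refine Continuous.continuousOn ?_ |>.integrableOn_compact hBc
      exact continuous_const.mul
        (ContinuousLinearMap.continuous_det.comp (by fun_prop)).abs
    · have h1 := hδle x hx
      have h2 := hC₀ x hx
      have h3 : 0 ≤ C - ‖x + v x‖ ^ 2 := by nlinarith [norm_nonneg (x + v x)]
      refine (le_abs_self _).trans ?_
      simp only [q, one_smul, abs_mul, abs_pow, abs_of_nonneg h3]
      gcongr
  set ρ := min (δ / 2) R
  have hρ : 0 < ρ := by positivity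
  have hlower : ∀ k, (C - (δ / 2) ^ 2) ^ k * volume.real (Metric.ball (0 : E) ρ) ≤
      ∫ x in Metric.closedBall (0 : E) R, (C - ‖x‖ ^ 2) ^ k := by
    intro k
    have hcc : Continuous fun x : E => (C - ‖x‖ ^ 2) ^ k := by fun_prop
    have hsub : Metric.ball (0 : E) ρ ⊆ Metric.closedBall 0 R :=
      Metric.ball_subset_closedBall.trans (Metric.closedBall_subset_closedBall (min_le_right _ _))
    have hi := hcc.continuousOn.integrableOn_compact (μ := volume) hBc
    calc (C - (δ / 2) ^ 2) ^ k * volume.real (Metric.ball (0 : E) ρ)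
        = ∫ x in Metric.ball (0 : E) ρ, (C - (δ / 2) ^ 2) ^ k := by
          rw [setIntegral_const, smul_eq_mul, mul_comm]
      _ ≤ ∫ x in Metric.ball (0 : E) ρ, (C - ‖x‖ ^ 2) ^ k := by
          refine setIntegral_mono_on (integrableOn_const measure_ball_lt_top.ne) (hi.mono_set hsub)
            Metric.isOpen_ball.measurableSet fun x hx => ?_
          have h1 : ‖x‖ < δ / 2 := (mem_ball_zero_iff.1 hx).trans_le (min_le_left _ _)
          have h2 : 0 ≤ C - (δ / 2) ^ 2 := by nlinarith
          gcongr
      _ ≤ _ := by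
          refine setIntegral_mono_set hi ?_ hsub.eventuallyLE
          refine (ae_restrict_iff' Metric.isClosed_closedBall.measurableSet).2
            (Eventually.of_forall fun x hx => ?_)
          have h1 : ‖x‖ ≤ R := mem_closedBall_zero_iff.1 hx
          have h2 : 0 ≤ C - ‖x‖ ^ 2 := by nlinarith [norm_nonneg x, sq_nonneg C₀]
          exact pow_nonneg h2 k
  have hvol : 0 < volume.real (Metric.ball (0 : E) ρ) :=
    ENNReal.toReal_pos (Metric.measure_ball_pos _ _ hρ).ne' measure_ball_lt_top.ne
  have hb : 0 < C - (δ / 2) ^ 2 := by nlinarith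
  have hlim : Tendsto (fun k : ℕ => ((C - δ ^ 2) / (C - (δ / 2) ^ 2)) ^ k * D) atTop
      (𝓝 (0 * D)) := by
    refine (tendsto_pow_atTop_nhds_zero_of_lt_one (by positivity) ?_).mul_const D
    rw [div_lt_one hb]
    nlinarith
  rw [zero_mul] at hlim
  refine hvol.not_ge (ge_of_tendsto' hlim fun k => ?_)
  rw [div_pow, div_mul_eq_mul_div, le_div_iff₀ (pow_pos hb k), mul_comm]
  exact (hlower k).trans (hupper k)

/-- A continuous vector field on a Euclidean space which points outwards off a ball has a zero. -/
theorem exists_eq_zero_of_inner_pos {G : E → E} (hG : Continuous G) {R : ℝ}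
    (hGR : ∀ x, R ≤ ‖x‖ → 0 < inner ℝ (G x) x) : ∃ x, G x = 0 := by
  by_contra! hne
  wlog hR : 0 < R generalizing R
  · exact this (R := 1) (fun x hx => hGR x (by linarith)) one_pos
  let χ : E → ℝ := fun x => max 0 (min 1 (‖x‖ - R))
  have hχc : Continuous χ := by fun_prop
  have hχ0 : ∀ x, 0 ≤ χ x := fun x => le_max_left _ _
  have hχ1 : ∀ x, χ x ≤ 1 := fun x => max_le zero_le_one (min_le_left _ _)
  let u : E → E := fun x => (1 - χ x) • (G x - x)
  have huc : Continuous u := by fun_prop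
  have huR : ∀ x, R + 1 ≤ ‖x‖ → u x = 0 := by
    intro x hx
    have : χ x = 1 := by
      simp only [χ]
      rw [min_eq_left (by linarith), max_eq_right zero_le_one]
    simp [u, this]
  have hune : ∀ x, x + u x ≠ 0 := by
    intro x h0
    rcases le_or_gt R ‖x‖ with hx | hx
    · have h1 : inner ℝ (x + u x) x = χ x * ‖x‖ ^ 2 + (1 - χ x) * inner ℝ (G x) x := by
        simp only [u, inner_add_left, inner_smul_left, inner_sub_left, real_inner_self_eq_norm_sq]
        simp; ring
      rw [h0, inner_zero_left] at h1
      have h2 := hGR x hx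
      have h3 : 0 < ‖x‖ ^ 2 := by have := hR.trans_le hx; positivity
      have h4 := hχ0 x
      have h5 := hχ1 x
      rcases h4.eq_or_lt with h | h
      · rw [← h] at h1; linarith
      · have := mul_pos h h3
        have := mul_nonneg (sub_nonneg.2 h5) h2.le
        linarith
    · have : χ x = 0 := by
        simp only [χ]
        exact max_eq_left ((min_le_right _ _).trans (by linarith))
      simp only [u, this, sub_zero, one_smul, add_sub_cancel] at h0
      exact hne x h0
  obtain ⟨x₀, -, hx₀⟩ := (isCompact_closedBall (0 : E) (R + 2)).exists_isMinOn
    ⟨0, by simp; linarith⟩ (continuous_id.add huc).norm.continuousOn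
  set δ := ‖x₀ + u x₀‖
  have hδ : 0 < δ := norm_pos_iff.2 (hune x₀)
  have husupp : HasCompactSupport u :=
    HasCompactSupport.intro (isCompact_closedBall (0 : E) (R + 1)) fun x hx =>
      huR x (by simp at hx; exact hx.le)
  obtain ⟨ε, hε, hεu⟩ := Metric.uniformContinuous_iff.1
    (husupp.uniformContinuous_of_continuous huc) (δ / 2) (half_pos hδ)
  obtain ⟨v, hv, hvu⟩ := huc.exists_contDiff_dist_le_of_forall_mem_ball_dist_le
    (lt_min one_pos hε)
  have hvR : ∀ x, R + 2 < ‖x‖ → v x = 0 := by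
    intro x hx
    have h1 : u x = 0 := huR x (by linarith)
    have h2 := hvu x 0 fun z hz => by
      have h3 : dist z x < 1 := (Metric.mem_ball.1 hz).trans_le (min_le_left _ _)
      rw [dist_eq_norm] at h3
      have h4 := norm_sub_norm_le x z
      rw [norm_sub_rev] at h3
      rw [h1, huR z (by linarith), dist_self]
    rw [h1] at h2
    exact dist_le_zero.1 h2
  obtain ⟨x, hx⟩ := exists_add_eq_zero_of_contDiff (hv.of_le (by simp)) (by linarith) hvR
  have h1 : dist (v x) (u x) ≤ δ / 2 := hvu x _ fun z hz =>
    (hεu ((Metric.mem_ball.1 hz).trans_le (min_le_right _ _))).le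
  rcases le_or_gt ‖x‖ (R + 2) with h | h
  · have h2 : δ ≤ ‖x + u x‖ := hx₀ (by simpa using h)
    have h3 : x + u x = u x - v x := by
      have h4 : v x = -x := (neg_eq_of_add_eq_zero_right hx).symm
      rw [h4]; abel
    rw [h3, ← dist_eq_norm, dist_comm] at h2
    linarith
  · rw [hvR x h, add_zero] at hx
    rw [hx, norm_zero] at h
    linarith

end Brouwer

section Galerkin

/-- A continuous vector field has a zero in `{ρ ≤ 0}` if it does not point inwards on `{ρ > 0}`,
the complement of a bounded set. -/
theorem exists_eq_zero_of_inner_nonneg {E : Type*} [NormedAddCommGroup E] [InnerProductSpace ℝ E]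
    [FiniteDimensional ℝ E] {F : E → E} (hF : Continuous F) {ρ : E → ℝ} (hρ : Continuous ρ)
    (h0 : ρ 0 ≤ 0) {R : ℝ} (hR : ∀ x, R ≤ ‖x‖ → 0 < ρ x)
    (hpos : ∀ x, 0 < ρ x → 0 ≤ inner ℝ (F x) x) : ∃ x, ρ x ≤ 0 ∧ F x = 0 := by
  obtain ⟨x, hx⟩ := exists_eq_zero_of_inner_pos (G := fun x => F x + max 0 (ρ x) • x)
    (by fun_prop) (R := max R 1) fun x hx => by
      have h1 := hR x ((le_max_left _ _).trans hx)
      have h2 : 0 < ‖x‖ := one_pos.trans_le ((le_max_right _ _).trans hx)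
      rw [inner_add_left, real_inner_smul_left, real_inner_self_eq_norm_sq, max_eq_right h1.le]
      exact add_pos_of_nonneg_of_pos (hpos x h1) (by positivity)
  rcases le_or_gt (ρ x) 0 with h | h
  · exact ⟨x, h, by simpa [max_eq_left h] using hx⟩
  · have h1 : inner ℝ (F x + max 0 (ρ x) • x) x = 0 := by rw [hx, inner_zero_left]
    rw [inner_add_left, real_inner_smul_left, real_inner_self_eq_norm_sq, max_eq_right h.le] at h1
    have h2 : x = 0 := by
      by_contra h3
      have h4 : 0 < ρ x * ‖x‖ ^ 2 := by have := norm_pos_iff.2 h3; positivity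
      linarith [hpos x h]
    rw [h2] at h
    exact absurd h0 h.not_ge

/-- Solvability of the Galerkin equations `⟨P x, L w⟩ = 0` for `w` in a finite set. -/
theorem exists_galerkin_solution {V Y : Type*} [AddCommGroup V] [Module ℝ V]
    [NormedAddCommGroup Y] [NormedSpace ℝ Y] (L : V →ₗ[ℝ] StrongDual ℝ Y) (P : V → Y) (ρ : V → ℝ)
    (hT : ∀ (n : ℕ) (T : EuclideanSpace ℝ (Fin n) →ₗ[ℝ] V), Function.Injective T →
      (∀ w, Continuous fun c => L w (P (T c))) ∧ (Continuous fun c => ρ (T c)) ∧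
        ∃ R, ∀ c, R ≤ ‖c‖ → 0 < ρ (T c))
    (h0 : ρ 0 ≤ 0) (hpos : ∀ w, 0 < ρ w → 0 ≤ L w (P w)) :
    ∀ s : Set V, s.Finite → ∃ x, ρ x ≤ 0 ∧ ∀ w ∈ s, L w (P x) = 0 := by
  intro s hs
  let W := Submodule.span ℝ s
  have : FiniteDimensional ℝ W := FiniteDimensional.span_of_finite ℝ hs
  let e : EuclideanSpace ℝ (Fin (Module.finrank ℝ W)) ≃ₗ[ℝ] W :=
    LinearEquiv.ofFinrankEq _ _ (by simp)
  let T := W.subtype ∘ₗ e.toLinearMap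
  obtain ⟨hc, hρ, R, hR⟩ := hT _ T (W.injective_subtype.comp e.injective)
  let b := EuclideanSpace.basisFun (Fin (Module.finrank ℝ W)) ℝ
  let F (c : EuclideanSpace ℝ (Fin (Module.finrank ℝ W))) :
      EuclideanSpace ℝ (Fin (Module.finrank ℝ W)) :=
    WithLp.toLp 2 fun i => L (T (b i)) (P (T c))
  have hF : Continuous F :=
    (PiLp.continuous_toLp 2 _).comp (continuous_pi fun i => hc (T (b i)))
  have hinner : ∀ c d, inner ℝ (F c) d = L (T d) (P (T c)) := by
    intro c d
    conv_rhs => rw [← b.sum_repr d]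
    simp [F, PiLp.inner_apply, b, map_sum]
  obtain ⟨c, hcρ, hc0⟩ := exists_eq_zero_of_inner_nonneg hF hρ (by simpa using h0) hR
    fun c hcρ => by rw [hinner]; exact hpos _ hcρ
  refine ⟨T c, hcρ, fun w hw => ?_⟩
  have h1 := hinner c (e.symm ⟨w, Submodule.subset_span hw⟩)
  rw [hc0, inner_zero_left] at h1
  simpa [T] using h1.symm

theorem continuous_of_exists_subseq {E F : Type*} [TopologicalSpace E] [FirstCountableTopology E]
    [TopologicalSpace F] {φ : E → F} (h : ∀ (u : ℕ → E) (a : E), Tendsto u atTop (𝓝 a) →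
      ∃ k : ℕ → ℕ, Tendsto (fun n => φ (u (k n))) atTop (𝓝 (φ a))) : Continuous φ :=
  continuous_iff_continuousAt.2 fun a => tendsto_of_subseq_tendsto fun u hu => h u a hu

end Galerkin

section Weak

variable {E : Type*} [NormedAddCommGroup E] [NormedSpace ℝ E]

theorem WeakTendsto.of_tendsto {u : ℕ → E} {a : E} (h : Tendsto u atTop (𝓝 a)) :
    WeakTendsto u a := fun l => (l.continuous.tendsto a).comp h

/-- A separable set is separated from `0` by countably many functionals out of a given dense set. -/
theorem TopologicalSpace.IsSeparable.exists_seq_dual_separating {Q : Set E}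
    (hQ : IsSeparable Q) {V : Set (StrongDual ℝ E)} (hV : Dense V) :
    ∃ l : ℕ → StrongDual ℝ E, (∀ i, l i ∈ V) ∧ ∀ v ∈ Q, (∀ i, l i v = 0) → v = 0 := by
  obtain ⟨c, hc, hQc⟩ := hQ
  obtain ⟨y, hy⟩ := (hc.insert 0).exists_eq_range (insert_nonempty 0 c)
  have key : ∀ i, ∃ w ∈ V, ‖w‖ ≤ 2 ∧ ‖y i‖ / 2 ≤ w (y i) := by
    intro i
    obtain ⟨l, hl1, hl⟩ := exists_dual_vector'' ℝ (y i)
    obtain ⟨w, hwV, hw⟩ := hV.exists_dist_lt l (half_pos one_pos)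
    rw [dist_eq_norm] at hw
    refine ⟨w, hwV, ?_, ?_⟩
    · have := norm_sub_norm_le w l
      rw [norm_sub_rev] at this
      linarith
    · have h1 := (l - w).le_of_opNorm_le hw.le (y i)
      rw [sub_apply, hl] at h1
      have h2 := le_abs_self (‖y i‖ - w (y i))
      rw [Real.norm_eq_abs] at h1
      simp only [RCLike.ofReal_real_eq_id, id_eq] at h1
      linarith
  choose l hlV hl2 hly using key
  refine ⟨l, hlV, fun v hv h0 => ?_⟩
  by_contra hne
  have hpos := norm_pos_iff.2 hne
  obtain ⟨z, hz, hvz⟩ := Metric.mem_closure_iff.1 (hQc hv) (‖v‖ / 5) (by positivity)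
  obtain ⟨i, rfl⟩ : z ∈ range y := hy ▸ mem_insert_of_mem _ hz
  have h1 := (l i).le_of_opNorm_le (hl2 i) (y i - v)
  rw [map_sub, h0, sub_zero] at h1
  rw [dist_eq_norm] at hvz
  have h2 := hly i
  have h3 := le_abs_self (l i (y i))
  rw [Real.norm_eq_abs] at h1
  have h4 := norm_sub_norm_le v (y i)
  rw [norm_sub_rev (y i) v] at h1
  linarith

/-- In a reflexive separable space, bounded sequences of functionals have weakly convergent
subsequences. -/
theorem exists_subseq_weakTendsto_dual [TopologicalSpace.SeparableSpace E]
    (hE : IsReflexiveSpace E) {u : ℕ → StrongDual ℝ E} {R : ℝ} (hu : ∀ n, ‖u n‖ ≤ R) :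
    ∃ (k : ℕ → ℕ) (a : StrongDual ℝ E), StrictMono k ∧ WeakTendsto (fun n => u (k n)) a := by
  obtain ⟨a, -, k, hk, ha⟩ := WeakDual.isSeqCompact_closedBall ℝ E 0 R
    (x := fun n => StrongDual.toWeakDual (u n)) fun n => by simpa using hu n
  refine ⟨k, WeakDual.toStrongDual a, hk, fun l => ?_⟩
  obtain ⟨x, rfl⟩ := hE l
  simp only [NormedSpace.dual_def]
  exact ((WeakDual.eval_continuous x).tendsto a).comp ha

theorem Convex.isClosed_toWeakSpace_image {s : Set E} (hs : Convex ℝ s) (hc : IsClosed s) :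
    IsClosed (toWeakSpace ℝ E '' s) := by
  have h := hs.toWeakSpace_closure (𝕜 := ℝ)
  rw [hc.closure_eq] at h
  rw [h]
  exact isClosed_closure

end Weak

namespace PNSpace

variable {X Z B Y : Type*} [NormedAddCommGroup X] [NormedSpace ℝ X]
  [AddCommGroup Z] [Module ℝ Z] [TopologicalSpace Z]
  [NormedAddCommGroup B] [NormedSpace ℝ B]
  [NormedAddCommGroup Y] [NormedSpace ℝ Y]

theorem isometry_coord (M : PNSpace X Z B) : Isometry M.coord := fun _ _ => rfl

theorem continuous_pnorm (M : PNSpace X Z B) : Continuous M.pnorm :=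
  M.ψ.symm.continuous.comp M.isometry_coord.continuous.nnnorm

theorem ψ_pnorm (M : PNSpace X Z B) (x : M.Pt) : M.ψ (M.pnorm x) = ‖M.coord x‖₊ :=
  M.ψ.apply_symm_apply _

theorem exists_nnnorm_coord_le (M : PNSpace X Z B) (r : ℝ≥0) :
    ∃ C : ℝ≥0, ∀ x : M.Pt, M.pnorm x ≤ r → ‖M.coord x‖₊ ≤ C := by
  obtain ⟨C, hC⟩ := (isCompact_Icc (a := (0 : ℝ≥0)) (b := r)).bddAbove_image
    M.ψ.continuous.continuousOn
  exact ⟨C, fun x hx => M.ψ_pnorm x ▸ hC (mem_image_of_mem _ ⟨zero_le, hx⟩)⟩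

theorem exists_pnorm_le (M : PNSpace X Z B) (C : ℝ≥0) :
    ∃ r : ℝ≥0, ∀ x : M.Pt, ‖M.coord x‖₊ ≤ C → M.pnorm x ≤ r := by
  obtain ⟨r, hr⟩ := (isCompact_Icc (a := (0 : ℝ≥0)) (b := C)).bddAbove_image
    M.ψ.symm.continuous.continuousOn
  exact ⟨r, fun x hx => hr (mem_image_of_mem _ ⟨zero_le, hx⟩)⟩

/-- In a reflexive `pn`-space, bounded sequences have weakly convergent subsequences. -/
theorem Reflexive.exists_subseq {M : PNSpace X Z B} (hM : M.Reflexive) {u : ℕ → M.Pt} {r : ℝ≥0}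
    (hu : ∀ n, M.pnorm (u n) ≤ r) :
    ∃ (k : ℕ → ℕ) (a : M.Pt), StrictMono k ∧ M.WeakTendsto (fun n => u (k n)) a := by
  obtain ⟨C, hC⟩ := M.exists_nnnorm_coord_le r
  obtain ⟨r', hr'⟩ := M.exists_pnorm_le C
  let Q : Submodule ℝ B := (Submodule.span ℝ (range fun n => M.coord (u n))).topologicalClosure
  have hQsep : TopologicalSpace.IsSeparable (Q : Set B) :=
    ((countable_range _).isSeparable.span (R := ℝ)).closure
  obtain ⟨l, -, hl⟩ := hQsep.exists_seq_dual_separating dense_univ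
  let D : Set B := Metric.closedBall 0 C ∩ Q
  have hD : IsClosed (toWeakSpace ℝ B '' D) :=
    ((convex_closedBall _ _).inter Q.convex).isClosed_toWeakSpace_image
      (Metric.isClosed_closedBall.inter (Submodule.isClosed_topologicalClosure _))
  let A : Set M.Pt := M.coord ⁻¹' D
  have hA : IsClosed[M.weakTopology] A := by
    refine isClosed_induced_iff.2 ⟨_, hD, ?_⟩
    ext x
    simp [A]
  have hAb : ∀ x ∈ A, M.pnorm x ≤ r' := fun x hx => hr' x <| by
    have := hx.1
    rw [mem_closedBall_zero_iff] at this
    exact_mod_cast this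
  have hcomp := hM A ⟨r', hAb⟩ hA
  let _ : TopologicalSpace M.Pt := M.weakTopology
  have hlc : ∀ m : StrongDual ℝ B, Continuous fun x : M.Pt => m (M.coord x) := by
    intro m
    have h1 : Continuous fun x : M.Pt => toWeakSpace ℝ B (M.coord x) := continuous_induced_dom
    exact (WeakBilin.eval_continuous (topDualPairing ℝ B).flip m).comp h1
  have : CompactSpace A := isCompact_iff_compactSpace.1 hcomp
  have : TopologicalSpace.MetrizableSpace A :=
    Metric.PiNatEmbed.TopologicalSpace.MetrizableSpace.of_countable_separating
      (fun n (x : A) => l n (M.coord x))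
      (fun n => (hlc (l n)).comp continuous_subtype_val) fun x y hxy => by
        by_contra! h
        refine hxy (Subtype.ext (M.coord_injective (sub_eq_zero.1 (hl _ ?_ fun i => ?_))))
        · exact Q.sub_mem x.2.2 y.2.2
        · rw [map_sub, h, sub_self]
  have huA : ∀ n, u n ∈ A := fun n => by
    refine ⟨?_, ?_⟩
    · rw [mem_closedBall_zero_iff]
      exact_mod_cast hC _ (hu n)
    · exact Submodule.le_topologicalClosure _ (Submodule.subset_span ⟨n, rfl⟩)
  obtain ⟨a, k, hk, ha⟩ := SeqCompactSpace.tendsto_subseq fun n => (⟨u n, huA n⟩ : A)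
  exact ⟨k, a, hk, fun m => (((hlc m).comp continuous_subtype_val).tendsto a).comp ha⟩

end PNSpace

namespace PNSpace

variable {X Z B Y : Type*} [NormedAddCommGroup X] [NormedSpace ℝ X]
  [AddCommGroup Z] [Module ℝ Z] [TopologicalSpace Z]
  [NormedAddCommGroup B] [NormedSpace ℝ B]
  [NormedAddCommGroup Y] [NormedSpace ℝ Y]

/-- Multiplication by small scalars maps bounded sets of a `pn`-space near `0`. -/
theorem exists_nnnorm_coord_smul_lt (M : PNSpace X Z B) (C : ℝ≥0) {m : ℝ≥0} (hm : 0 < m) :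
    ∃ δ : ℝ, 0 < δ ∧ ∀ (t : ℝ), 0 < t → t < δ → ∀ x x' : M.Pt, x'.val = t • x.val →
      ‖M.coord x‖₊ ≤ C → ‖M.coord x'‖₊ < m := by
  obtain ⟨ν, K, hν, hs⟩ := M.scaling
  obtain ⟨c₀, c₁, hc, h0, -⟩ := hν.limits
  have hc0 : c₀ < 2 := by
    rcases hc with h | h <;> rw [h.1] <;> norm_num
  have h1 := h0.eventually_lt_const hc0
  rw [eventually_comap] at h1
  obtain ⟨a, ha, hab⟩ := (mem_nhdsGT_iff_exists_Ioo_subset' zero_lt_one).1 h1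
  rw [mem_Ioi] at ha
  obtain ⟨ε, hε0, hε⟩ := ENNReal.lt_iff_exists_nnreal_btwn.1 (lt_min ha hν.K_pos)
  have hε0' : 0 < ε := by exact_mod_cast hε0
  have hCm : 0 < m / (2 * (C + 1)) := by positivity
  refine ⟨(min ε (m / (2 * (C + 1))) : ℝ≥0), by exact_mod_cast lt_min hε0' hCm,
    fun t ht0 ht x x' hx' hx => ?_⟩
  lift t to ℝ≥0 using ht0.le
  have ht0' : 0 < t := by exact_mod_cast ht0
  obtain ⟨htε, htm⟩ : t < ε ∧ t < m / (2 * (C + 1)) := by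
    rw [← lt_min_iff]; exact_mod_cast ht
  have hte : ‖(t : ℝ)‖ₑ = t := by simp [enorm_eq_nnnorm]
  have htε' : (t : ℝ≥0∞) < min a K := (ENNReal.coe_lt_coe.2 htε).trans hε
  obtain ⟨-, b', hb', hle⟩ := hs x.val x.mem.1 (M.coord x) (M.incl_coord x).symm t
    (hte ▸ htε'.trans_le (min_le_right _ _))
  have hb : M.coord x' = b' := M.incl_injective (by rw [M.incl_coord, hx', hb'])
  have hνt : ν t / (t : ℝ≥0∞) < 2 := by
    have := hab ⟨by exact_mod_cast ht0', htε'.trans_le (min_le_left _ _)⟩ (t : ℝ) hte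
    rwa [hte] at this
  have hνt' : ν t ≤ 2 * t := by
    rw [ENNReal.div_lt_iff (Or.inl (by exact_mod_cast ht0'.ne')) (Or.inl ENNReal.coe_ne_top)] at hνt
    exact hνt.le
  have h2 : ‖M.coord x'‖ₑ ≤ ((2 * t * C : ℝ≥0) : ℝ≥0∞) := by
    rw [hb]
    refine hle.trans ?_
    push_cast
    gcongr
    rw [enorm_eq_nnnorm]
    exact_mod_cast hx
  have h3 : ‖M.coord x'‖₊ ≤ 2 * t * C := by
    rw [enorm_eq_nnnorm] at h2
    exact_mod_cast h2
  refine h3.trans_lt ?_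
  rw [lt_div_iff₀ (by positivity)] at htm
  calc 2 * t * C ≤ t * (2 * (C + 1)) := by
        rw [← NNReal.coe_le_coe]; push_cast; nlinarith [t.2, C.2]
    _ < m := htm

theorem coord_eq_zero_iff (M : PNSpace X Z B) (x : M.Pt) : M.coord x = 0 ↔ x.val = 0 := by
  constructor
  · intro h
    apply M.injOn_h x.mem.1 M.zero_mem_dom
    rw [M.h_zero, ← M.incl_coord, h, map_zero]
  · intro h
    apply M.incl_injective
    rw [M.incl_coord, h, M.h_zero, map_zero]

/-- The `p`-norm is coercive on finite-dimensional subspaces on which it is continuous. -/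
theorem exists_lt_pnorm {E : Type*} [NormedAddCommGroup E] [NormedSpace ℝ E]
    [FiniteDimensional ℝ E] (M : PNSpace X Z B) {T : E → M.Pt} (hT : Continuous T)
    (hsmul : ∀ (t : ℝ) c, (T (t • c)).val = t • (T c).val) (hinj : ∀ c, (T c).val = 0 → c = 0)
    (r : ℝ≥0) : ∃ R : ℝ, ∀ c, R ≤ ‖c‖ → r < M.pnorm (T c) := by
  obtain ⟨C, hC⟩ := M.exists_nnnorm_coord_le r
  obtain ⟨m, hm, hmle⟩ : ∃ m : ℝ≥0, 0 < m ∧ ∀ c : E, ‖c‖ = 1 → m ≤ ‖M.coord (T c)‖₊ := by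
    rcases (Metric.sphere (0 : E) 1).eq_empty_or_nonempty with h | h
    · refine ⟨1, one_pos, fun c hc => ?_⟩
      have : c ∈ Metric.sphere (0 : E) 1 := by simpa using hc
      rw [h] at this
      exact this.elim
    · obtain ⟨c₀, hc₀, hmin⟩ := (isCompact_sphere (0 : E) 1).exists_isMinOn h
        (M.isometry_coord.continuous.comp hT).nnnorm.continuousOn
      refine ⟨‖M.coord (T c₀)‖₊, ?_, fun c hc => hmin (by simpa using hc)⟩
      rw [nnnorm_pos, Ne, M.coord_eq_zero_iff]
      intro h0
      rw [hinj c₀ h0] at hc₀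
      simp at hc₀
  obtain ⟨δ, hδ, hsmall⟩ := M.exists_nnnorm_coord_smul_lt C hm
  refine ⟨2 / δ, fun c hc => ?_⟩
  by_contra! hle
  have hc0 : 0 < ‖c‖ := lt_of_lt_of_le (by positivity) hc
  have h1 : ‖c‖⁻¹ < δ := by
    rw [inv_lt_comm₀ hc0 hδ]
    refine lt_of_lt_of_le ?_ hc
    rw [inv_eq_one_div]
    gcongr
    norm_num
  refine (hsmall ‖c‖⁻¹ (by positivity) h1 (T c) _ (hsmul _ c) (hC _ hle)).not_ge (hmle _ ?_)
  rw [norm_smul, norm_inv, norm_norm, inv_mul_cancel₀ hc0.ne']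

/-- The limit of a weakly convergent sequence of Galerkin solutions solves the limit equations. -/
theorem WeaklyCompactMap.apply_sub_eq_zero {M : PNSpace X Z B} {f : X → Y}
    (hf : M.WeaklyCompactMap f) {y : Y} {l : ℕ → StrongDual ℝ Y} {u : ℕ → M.Pt}
    (hu : ∀ n, ∀ i < n, l i (f (u n).val - y) = 0) {k : ℕ → ℕ} (hk : StrictMono k) {a : M.Pt}
    (ha : M.WeakTendsto (fun n => u (k n)) a) (i : ℕ) : l i (f a.val - y) = 0 := by
  obtain ⟨k', hk', hlim⟩ := hf _ a ha
  have h1 : Tendsto (fun n => l i (f (u (k (k' n))).val - y)) atTop (𝓝 (l i (f a.val - y))) := by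
    simp only [map_sub]
    exact (hlim (l i)).sub_const _
  refine tendsto_nhds_unique_of_eventuallyEq h1 tendsto_const_nhds ?_
  filter_upwards [eventually_gt_atTop i] with n hn
  exact hu _ i (hn.trans_le ((hk.comp hk').le_apply))

end PNSpace

section Solvability

variable {X Z B Y : Type*} [NormedAddCommGroup X] [NormedSpace ℝ X]
  [AddCommGroup Z] [Module ℝ Z] [TopologicalSpace Z]
  [NormedAddCommGroup B] [NormedSpace ℝ B]
  [NormedAddCommGroup Y] [NormedSpace ℝ Y]
  {M : PNSpace X Z B} {f : X → Y} {X₀ X₁ : Set X} {τ : TopologicalSpace X₀}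
  {g : X → StrongDual ℝ Y} {y : Y}

theorem ConditionAlpha.exists_solution (h : ConditionAlpha M g X₀ X₁ τ)
    (hf : M.WeaklyCompactMap f) {r : ℝ≥0}
    (hpos : ∀ x : M.Pt, x.val ∈ X₁ → r ≤ M.pnorm x → 0 ≤ g x.val (f x.val - y)) :
    ∃ x ∈ M.carrier, f x = y := by
  let V : Submodule ℝ X :=
    { carrier := X₀
      zero_mem' := h.isTVS.zero_mem
      add_mem' := h.isTVS.add_mem
      smul_mem' := fun c _ => h.isTVS.smul_mem c }
  let _ : TopologicalSpace V := τ
  have : ContinuousAdd V := ⟨h.isTVS.continuous_add⟩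
  have : ContinuousSMul ℝ V := ⟨h.isTVS.continuous_smul⟩
  have : TopologicalSpace.SeparableSpace V := h.separable
  let ι : V → M.Pt := fun x => ⟨x, h.subset_carrier x.2⟩
  have hι : Continuous ι := h.continuous_inclusion
  let L : V →ₗ[ℝ] StrongDual ℝ Y :=
    { toFun := fun x => g x
      map_add' := fun x x' => h.map_add x x.2 x' x'.2
      map_smul' := fun c x => h.map_smul c x x.2 }
  have hL : Continuous L := h.continuous_map
  have hsol := exists_galerkin_solution L (fun x => f x - y)
    (fun x => (M.pnorm (ι x) : ℝ) - max r (M.pnorm (ι 0))) (fun n T hT => ?_)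
    (sub_nonpos.2 (by exact_mod_cast le_max_right _ _)) (fun w hw => ?_)
  · choose u hur hu using fun n : ℕ =>
      hsol _ (((finite_Iio n).image (TopologicalSpace.denseSeq V)))
    obtain ⟨k, a, hk, ha⟩ := h.reflexive.exists_subseq (u := fun n => ι (u n))
      (r := max r (M.pnorm (ι 0))) fun n => by
        have := sub_nonpos.1 (hur n)
        exact_mod_cast this
    refine ⟨a.val, a.mem, sub_eq_zero.1 (h.ker_adjoint _ fun x hx => ?_)⟩
    have hu' : ∀ n, ∀ i < n, L (TopologicalSpace.denseSeq V i) (f (ι (u n)).val - y) = 0 :=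
      fun n i hi => hu n _ ⟨i, hi, rfl⟩
    have h1 := hf.apply_sub_eq_zero hu' hk ha
    have h2 : Continuous fun x : V => L x (f a.val - y) := hL.clm_apply continuous_const
    have h3 := (TopologicalSpace.denseRange_denseSeq V).equalizer h2
      (continuous_const (y := (0 : ℝ))) (funext h1)
    exact congrFun h3 ⟨x, hx⟩
  · have hTc : Continuous T := by
      have : (T : EuclideanSpace ℝ (Fin n) → V) = fun c =>
          ∑ i, c i • T (EuclideanSpace.basisFun _ ℝ i) := by
        funext c
        conv_lhs => rw [← (EuclideanSpace.basisFun (Fin n) ℝ).sum_repr c]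
        simp [map_sum]
      rw [this]
      fun_prop
    have hιT : Continuous fun c => ι (T c) := hι.comp hTc
    refine ⟨fun w => ?_, ?_, ?_⟩
    · refine continuous_of_exists_subseq fun v c hv => ?_
      have h1 : M.WeakTendsto (fun n => ι (T (v n))) (ι (T c)) :=
        WeakTendsto.of_tendsto (((M.isometry_coord.continuous.comp hιT).tendsto c).comp hv)
      obtain ⟨k, -, hk⟩ := hf _ _ h1
      refine ⟨k, ?_⟩
      simp only [map_sub]
      exact (hk (L w)).sub_const _
    · exact (NNReal.continuous_coe.comp (M.continuous_pnorm.comp hιT)).sub continuous_const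
    · obtain ⟨R, hR⟩ := M.exists_lt_pnorm hιT (fun t c => by simp [ι])
        (fun c hc => hT (by rw [map_zero]; exact Subtype.ext hc)) (max r (M.pnorm (ι 0)))
      exact ⟨R, fun c hc => sub_pos.2 (by exact_mod_cast hR c hc)⟩
  · refine hpos (ι w) (h.dom_eq ▸ w.2) ?_
    have h1 := sub_pos.1 hw
    have h2 : max r (M.pnorm (ι 0)) < M.pnorm (ι w) := by exact_mod_cast h1
    exact (le_max_left _ _).trans h2.le

theorem ConditionBeta.exists_solution (h : ConditionBeta M g X₁) (hX₁ : X₁ ⊆ M.carrier)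
    (hf : M.WeaklyCompactMap f) {r : ℝ≥0}
    (hpos : ∀ x : M.Pt, x.val ∈ X₁ → r ≤ M.pnorm x → 0 ≤ g x.val (f x.val - y)) :
    ∃ x ∈ M.carrier, f x = y := by
  have := h.separable
  obtain ⟨V, hVd, hV⟩ := h.dense_image
  have hinv : ∀ z : V, ∃ x : M.Pt, x.val ∈ X₁ ∧ g x.val = z := fun z => by
    obtain ⟨x, hx, hxz⟩ := hV z.2
    exact ⟨⟨x, hX₁ hx⟩, hx, hxz⟩
  choose p hpX hpg using hinv
  obtain ⟨R, hR⟩ := h.bounded r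
  obtain ⟨l, hlV, hl⟩ := (TopologicalSpace.IsSeparable.of_separableSpace
    (univ : Set Y)).exists_seq_dual_separating hVd
  have hsol := exists_galerkin_solution V.subtype (fun z => f (p z).val - y)
    (fun z => ‖z‖ - max R 0) (fun n T hT => ?_) (by simp) (fun w hw => ?_)
  · choose u hur hu using fun n : ℕ =>
      hsol _ (((finite_Iio n).image fun i => (⟨l i, hlV i⟩ : V)))
    obtain ⟨k, z, hk, hz⟩ := exists_subseq_weakTendsto_dual h.reflexive
      (u := fun n => (u n : StrongDual ℝ Y)) fun n => sub_nonpos.1 (hur n)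
    obtain ⟨k', hk', a, ha, -⟩ := h.inverse (fun n => p (u (k n))) z (fun n => hpX _)
      (by simpa only [hpg] using hz)
    refine ⟨a.val, a.mem, sub_eq_zero.1 (hl _ (mem_univ _) fun i => ?_)⟩
    exact hf.apply_sub_eq_zero (l := l) (u := fun n => p (u n))
      (fun n i hi => hu n _ (mem_image_of_mem _ hi)) (hk.comp hk') ha i
  · have hTc : Continuous T := LinearMap.continuous_of_finiteDimensional (F' := V) T
    refine ⟨fun w => ?_, ?_, ?_⟩
    · refine continuous_of_exists_subseq fun v c hv => ?_
      have h1 : WeakTendsto (fun n => (T (v n) : StrongDual ℝ Y)) (T c) :=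
        WeakTendsto.of_tendsto (((continuous_subtype_val.comp hTc).tendsto c).comp hv)
      obtain ⟨k, hk, a, ha, hax⟩ := h.inverse (fun n => p (T (v n))) (T c) (fun n => hpX _)
        (by simpa only [hpg] using h1)
      rw [hax (p (T c)) (hpX _) (hpg _)] at ha
      obtain ⟨k', -, hlim⟩ := hf _ _ ha
      refine ⟨fun n => k (k' n), ?_⟩
      simp only [map_sub]
      exact (hlim w).sub_const _
    · have h1 : Continuous fun c => ‖(T c : StrongDual ℝ Y)‖ :=
        (continuous_subtype_val.comp hTc).norm
      exact h1.sub continuous_const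
    · obtain ⟨K, hK0, hK⟩ := (V.subtype ∘ₗ T).exists_antilipschitzWith
        (LinearMap.ker_eq_bot.2 (V.injective_subtype.comp hT))
      refine ⟨K * (max R 0 + 1), fun c hc => sub_pos.2 ?_⟩
      have h1 := hK.le_mul_norm (map_zero _) c
      have h2 : max R 0 + 1 ≤ ‖T c‖ := le_of_mul_le_mul_left (hc.trans h1) (by exact_mod_cast hK0)
      linarith
  · have h1 : r ≤ M.pnorm (p w) := by
      by_contra! h2
      have h3 := hR (p w) (hpX w) h2.le
      rw [hpg] at h3
      have h4 := sub_pos.1 hw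
      exact absurd (h3.trans (le_max_left R 0)) h4.not_ge
    have h2 := hpos (p w) (hpX w) h1
    rwa [hpg] at h2

end Solvability

theorem theorem2 {X Y Z B : Type*}
    [NormedAddCommGroup X] [NormedSpace ℝ X] [CompleteSpace X]
    [NormedAddCommGroup Y] [NormedSpace ℝ Y] [CompleteSpace Y]
    [AddCommGroup Z] [Module ℝ Z] [TopologicalSpace Z] [IsTopologicalAddGroup Z]
    [ContinuousSMul ℝ Z] [LocallyConvexSpace ℝ Z]
    [NormedAddCommGroup B] [NormedSpace ℝ B] [CompleteSpace B]
    (M : PNSpace X Z B) (hM : M.WeaklyComplete)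
    (f : X → Y) (hf : M.WeaklyCompactMap f)
    (X₀ X₁ : Set X) (τ : TopologicalSpace X₀)
    (g : X → StrongDual ℝ Y) (φ : ℝ≥0 → ℝ)
    (hfg : CoercivePair M f g φ X₀ X₁ τ)
    (hαβ : ConditionAlpha M g X₀ X₁ τ ∨ ConditionBeta M g X₁)
    (y : Y)
    (hy : ∃ r : ℝ≥0, 0 < r ∧ ∀ x : M.Pt, x.val ∈ X₁ → r ≤ M.pnorm x →
      g x.val y ≤ φ (M.pnorm x) * M.pnorm x) :
    ∃ x ∈ M.carrier, f x = y := by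
  obtain ⟨r, -, hr⟩ := hy
  have hpos : ∀ x : M.Pt, x.val ∈ X₁ → r ≤ M.pnorm x → 0 ≤ g x.val (f x.val - y) := by
    intro x hx hxr
    rw [map_sub, sub_nonneg]
    exact (hr x hx hxr).trans (hfg.coercive x hx)
  rcases hαβ with h | h
  · exact h.exists_solution hf hpos
  · exact h.exists_solution hfg.subset_carrier hf hpos
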